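/- Let $l,m\ge 0$ and $n_1,\dots,n_l\ge 0$ be integers. For $i=1,\dots,l$ let $X_i\subseteq\mathbb R^{n_i}$ be closed and convex, $X=X_1\times\dots\times X_l$, let $f_i:X\to\mathbb R$ be continuous on $X$ and concave in its $i$-th variable, and let $h_i=(h_{i1},\dots,h_{im}):\mathbb R^{n_i}\to\mathbb R^m$ have convex components. Let $b\in\mathbb R^m$ and suppose that $D=\{x\in X:\sum_{i=1}^l h_i(x_i)\le b\}$ is nonempty (inequalities between vectors are componentwise). Put $$\Phi(x,y)=\sum_{i=1}^l\bigl[f_i(x)-f_i(x_{-i},y_i)\bigr].$$ A normalized equilibrium is a point $x^*\in D$ with $$\Phi(x^*,y)\ge 0\quad\text{for all } y\in D. \tag{2.1}$$ Let $U_0\subseteq\mathbb R^{ml}$ be such that $U=\{u=(u_1,\dots,u_l)\in U_0:\sum_{i=1}^l u_i=b\}$ is closed and convex and for each $x\in D$ there is $u\in U$ with $h_i(x_i)\le u_i$ for all $i$. Let $\varphi:\mathbb R^m\to[0,\infty)$ be convex, differentiable and isotone ($u\ge v$ implies $\varphi(u)\ge\varphi(v)$), with $\varphi(v)=0$ if $v\le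 0$ and $\varphi(v)>0$ otherwise, and for $w=(x,u)$ put $P(w)=\sum_{i=1}^l\varphi(h_i(x_i)-u_i)$. For $\tau>0$ the penalized problem is to find $w(\tau)=(x(\tau),u(\tau))\in X\times U$ with $$\Phi(x(\tau),x)+\tau\,[P(w)-P(w(\tau))]\ge 0\quad\text{for all } w=(x,u)\in X\times U. \tag{3.1}$$ A real function is called weakly coercive with respect to a set if at least one of its level sets $\{\,\cdot\le\rho\}$, $\rho\in\mathbb R$, in that set is nonempty and bounded. Suppose that $\mu:X\to\mathbb R$ is lower semicontinuous, convex and weakly coercive with respect to $X$, and that $r\in\mathbb R$ is such that, with $B_r=\{x\in X:\mu(x)\le r\}$, for every $x\in X\setminus B_r$ there is $z\in D$ with $\mu(z)\le\mu(x)$ and $\Phi(x,z)<0$. Put $\eta(w)=\max\{\mu(x),P(w)\}$ for $w=(x,u)$ and $E_r=\{w\in X\times U:\eta(w)\le r\}$. Let $(\tau_k)$ be a sequence of positive numbers with $\tau_k\to+\infty$. Then: (i) problem (2.1) has a solution; (ii) $\eta$ is weakly coercive with respect to $X\times U$; there is $\tau'>0$ such that for every $\tau>\tau'$ problem (3.1)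 has a solution and, if $r>0$, all its solutions belong to $E_r$; (iii) every sequence $(w(\tau_k))$, where $w(\tau_k)$ solves (3.1) with $\tau=\tau_k$, has limit points; every limit point $(\bar x,\bar u)$ belongs to $(B_r\cap D)\times U$, and $\bar x$ solves (2.1). -/

import Mathlib

/-- The level set `{x ∈ S | η x ≤ r}`. -/
def levelSet {α : Type*} (S : Set α) (η : α → ℝ) (r : ℝ) : Set α :=
  {x | x ∈ S ∧ η x ≤ r}

/-- `η` is weakly coercive with respect to `S`: some level set of `η` on `S` is nonempty and
bounded. -/
def WeaklyCoerciveOn {α : Type*} [Bornology α] (S : Set α) (η : α → ℝ) : Prop :=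
  ∃ r : ℝ, (levelSet S η r).Nonempty ∧ Bornology.IsBounded (levelSet S η r)

/-- The data of a generalized `l`-person game with `m` joint constraints. Utilities are total
functions, but only their values on the product of the strategy sets are ever used. -/
structure JointGame (l m : ℕ) where
  /-- dimension of the strategy space of each player -/
  n : Fin l → ℕ
  /-- strategy sets -/
  strat : (i : Fin l) → Set (EuclideanSpace ℝ (Fin (n i)))
  /-- utility functions -/
  f : Fin l → ((i : Fin l) → EuclideanSpace ℝ (Fin (n i))) → ℝ
  /-- constraint functions -/
  h : (i : Fin l) → EuclideanSpace ℝ (Fin (n i)) → Fin m → ℝ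
  /-- right-hand side of the joint constraint -/
  b : Fin m → ℝ

namespace JointGame

variable {l m : ℕ} (G : JointGame l m)

/-- Joint strategies `x = (x_1, …, x_l)`. -/
abbrev Profile : Type := (i : Fin l) → EuclideanSpace ℝ (Fin (G.n i))

/-- `X = X_1 × ⋯ × X_l`. -/
def X : Set G.Profile := {x | ∀ i, x i ∈ G.strat i}

/-- The joint constraint set `Y`. -/
def Y : Set G.Profile := {x | ∑ i, G.h i (x i) ≤ G.b}

/-- The common feasible set `D = X ∩ Y`. -/
def D : Set G.Profile := G.X ∩ G.Y

/-- `Ψ(x, y) = ∑ i, f_i(x_{-i}, y_i)`. -/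
noncomputable def Psi (x y : G.Profile) : ℝ := ∑ i, G.f i (Function.update x i (y i))

/-- The Nikaido–Isoda bifunction `Φ(x, y) = Ψ(x, x) - Ψ(x, y)`. -/
noncomputable def Phi (x y : G.Profile) : ℝ := G.Psi x x - G.Psi x y

/-- The basic assumptions on the game. -/
structure BasicAssumptions : Prop where
  strat_convex : ∀ i, Convex ℝ (G.strat i)
  strat_closed : ∀ i, IsClosed (G.strat i)
  utility_concave : ∀ i, ∀ x ∈ G.X,
    ConcaveOn ℝ (G.strat i) (fun y => G.f i (Function.update x i y))
  utility_continuous : ∀ i, ContinuousOn (G.f i) G.X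
  constraint_convex : ∀ i j, ConvexOn ℝ Set.univ (fun y => G.h i y j)
  feasible_nonempty : G.D.Nonempty

/-- `x` is a normalized equilibrium point: `x ∈ D` and `Φ(x, y) ≥ 0` for all `y ∈ D`. -/
def IsNormalizedEquilibrium (x : G.Profile) : Prop :=
  x ∈ G.D ∧ ∀ y ∈ G.D, 0 ≤ G.Phi x y

/-- The coercivity condition on `μ : X → ℝ` and the number `r`. -/
structure Coercivity (μ : G.Profile → ℝ) (r : ℝ) : Prop where
  lsc : LowerSemicontinuousOn μ G.X
  convex : ConvexOn ℝ G.X μ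
  weaklyCoercive : WeaklyCoerciveOn G.X μ
  descent : ∀ x ∈ G.X \ levelSet G.X μ r, ∃ z ∈ G.D, μ z ≤ μ x ∧ G.Phi x z < 0

/-- The feasible partitions `u = (u_1, …, u_l)` of `b` that satisfy the additional
restrictions `U₀`. -/
def U (U₀ : Set (Fin l → Fin m → ℝ)) : Set (Fin l → Fin m → ℝ) :=
  {u | u ∈ U₀ ∧ ∑ i, u i = G.b}

/-- The requirements on the restriction set: `U` is closed and convex, and every jointly
feasible strategy is feasible for some partition in `U`. -/
structure AdmissibleRestriction (U₀ : Set (Fin l → Fin m → ℝ)) : Prop where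
  closed : IsClosed (G.U U₀)
  convex : Convex ℝ (G.U U₀)
  covers : ∀ x ∈ G.D, ∃ u ∈ G.U U₀, ∀ i, G.h i (x i) ≤ u i

/-- The penalty `P(x, u) = ∑ i, φ(h_i(x_i) - u_i)`. -/
noncomputable def P (φ : (Fin m → ℝ) → ℝ) (w : G.Profile × (Fin l → Fin m → ℝ)) : ℝ :=
  ∑ i, φ (G.h i (w.1 i) - w.2 i)

/-- `w = (x, u)` solves the penalized equilibrium problem on `X × U` with parameter `τ`. -/
def IsPenaltySolution (U₀ : Set (Fin l → Fin m → ℝ)) (φ : (Fin m → ℝ) → ℝ) (τ : ℝ)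
    (w : G.Profile × (Fin l → Fin m → ℝ)) : Prop :=
  w ∈ G.X ×ˢ G.U U₀ ∧
    ∀ w' ∈ G.X ×ˢ G.U U₀, 0 ≤ G.Phi w.1 w'.1 + τ * (G.P φ w' - G.P φ w)

/-- `η(x, u) = max {μ(x), P(x, u)}`. -/
noncomputable def eta (φ : (Fin m → ℝ) → ℝ) (μ : G.Profile → ℝ)
    (w : G.Profile × (Fin l → Fin m → ℝ)) : ℝ :=
  max (μ w.1) (G.P φ w)

end JointGame

/-- The requirements on the penalty generator `φ : ℝ^m → ℝ₊`; the order on `Fin m → ℝ` is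
the componentwise one. -/
structure IsPenaltyGenerator {m : ℕ} (φ : (Fin m → ℝ) → ℝ) : Prop where
  convex : ConvexOn ℝ Set.univ φ
  differentiable : Differentiable ℝ φ
  isotone : Monotone φ
  eq_zero : ∀ v, v ≤ 0 → φ v = 0
  pos : ∀ v, ¬ v ≤ 0 → 0 < φ v

/-! Everything rests on the Ky Fan inequality: on a compact convex set, a bifunction Φ that is
continuous in the first variable, convex in the second and nonnegative on the diagonal admits a
point x with Φ(x, ·) ≥ 0. It is derived from Scarf's lemma, a parity argument, by way of closed
covers of the simplex.

The sets of the theorem may be unbounded, so the inequality is applied on a level set {μ ≤ ρ} of D,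
or {η ≤ ρ} of X × U, with ρ > r. Such sets are compact because a lower semicontinuous convex
function with one nonempty bounded level set has only bounded ones (`ConvexOn.isBounded_levelSet`).
The descent condition forces μ ≤ r at the point found; once this point is strictly inside the level
set, convexity extends the inequality to the whole set (`ConvexOn.nonneg_of_nonneg_on_levelSet`).

For the penalized problem, testing with a point y of D lifted to zero penalty gives τ P(w) ≤ Φ(x,
y). As Φ(·, z) is bounded on B_r for a fixed z in D, P(w) is O(1/τ). This yields existence and
location in E_r for large τ, compactness of the tail of the sequence, and P = 0 at limit points,
where Φ(·, y) ≥ 0 survives by continuity. -/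

/-! ### Scarf's lemma on dominant sets. -/

namespace Scarf

open Finset

variable {T I : Type*}

/-- `A` is dominant for the family of rankings `rk`: no point is ranked strictly above the
minimum of `A` by all rankings at once. -/
def Dominant (rk : I → T → ℕ) (A : Finset T) : Prop :=
  ∀ y, ∃ i, ∀ a ∈ A, rk i y ≤ rk i a

theorem Dominant.mono {rk : I → T → ℕ} {A B : Finset T} (hA : Dominant rk A) (h : B ⊆ A) :
    Dominant rk B := fun y => by
  obtain ⟨i, hi⟩ := hA y
  exact ⟨i, fun a ha => hi a (h ha)⟩

variable [Fintype T] [DecidableEq T] [Fintype I] [DecidableEq I]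

/-- A dominant set with one element less than there are rankings extends by one element to a
dominant set in exactly two ways, provided that points above its minimum for all rankings but one
exist. -/
theorem exists_pair_extensions {rk : I → T → ℕ} (hrk : ∀ i, Function.Injective (rk i))
    {B : Finset T} (hB : Dominant rk B) (hcard : #B + 1 = Fintype.card I) (hne : B.Nonempty)
    (hup : ∀ j, ∃ y, ∀ i, i ≠ j → ∃ b ∈ B, rk i b < rk i y) :
    ∃ a₀ a₁, a₀ ≠ a₁ ∧ a₀ ∉ B ∧ a₁ ∉ B ∧
      ∀ a, a ∉ B → (Dominant rk (insert a B) ↔ a = a₀ ∨ a = a₁) := by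
  classical
  have hmin : ∀ i, ∃ b ∈ B, ∀ b' ∈ B, rk i b ≤ rk i b' := fun i => exists_min_image B (rk i) hne
  choose mn hmnB hmn using hmin
  have hsurj : ∀ b ∈ B, ∀ i, (∀ a ∈ B, rk i b ≤ rk i a) → mn i = b := fun b hb i hi =>
    hrk i (le_antisymm (hmn i b hb) (hi _ (hmnB i)))
  -- Dominance at a point of `B` makes it the minimum of some ranking, so `mn` maps the rankings
  -- onto `B`, which has one element fewer: `i₀` and `i₁` are the only collision.
  obtain ⟨i₀, -, i₁, -, hi, he⟩ := exists_ne_map_eq_of_card_lt_of_maps_to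
    (s := univ) (t := B) (f := mn) (by rw [card_univ]; omega) (fun i _ => hmnB i)
  have hinj : ∀ k k', k ≠ k' → mn k = mn k' → Set.InjOn mn (univ.erase k' : Finset I) := by
    intro k k' hkk hk
    apply injOn_of_card_image_eq
    have : image mn (univ.erase k') = B := by
      ext b
      simp only [mem_image, mem_erase, mem_univ, and_true]
      constructor
      · rintro ⟨i, -, rfl⟩; exact hmnB i
      · intro hb
        obtain ⟨i, hi⟩ := hB b
        have := hsurj b hb i hi
        by_cases h : i = k'
        · exact ⟨k, hkk, by rw [hk, ← h, this]⟩
        · exact ⟨i, h, this⟩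
    rw [this, card_erase_of_mem (mem_univ _), card_univ]
    omega
  have hpair : ∀ i j, i ≠ j → mn i = mn j → j = i₀ ∨ j = i₁ := by
    intro i j hij h
    by_contra! hj
    have h0 := hinj i₀ i₁ hi he
    have h1 := hinj i₁ i₀ hi.symm he.symm
    by_cases hi1 : i = i₁
    · exact hij (h1 (by simp [hi1, hi.symm]) (by simp [hj.1]) h)
    · exact hij (h0 (by simp [hi1]) (by simp [hj.2]) h)
  -- A new point that becomes the minimum for `j` must lie above the minima of all other rankings,
  -- and be ranked highest by `j` among such points.
  have hlt : ∀ j, ∃ a, (∀ i, i ≠ j → rk i (mn i) < rk i a) ∧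
      ∀ y, (∀ i, i ≠ j → rk i (mn i) < rk i y) → rk j y ≤ rk j a := by
    intro j
    obtain ⟨y, hy⟩ := hup j
    obtain ⟨a, ha, hmax⟩ := exists_max_image
      (univ.filter fun y => ∀ i, i ≠ j → rk i (mn i) < rk i y) (rk j)
      ⟨y, by
        simp only [mem_filter, mem_univ, true_and]
        intro i hij
        obtain ⟨b, hb, hlt⟩ := hy i hij
        exact (hmn i b hb).trans_lt hlt⟩
    simp only [mem_filter, mem_univ, true_and] at ha hmax
    exact ⟨a, ha, hmax⟩
  choose mx hmx hmx' using hlt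
  have hnot : ∀ y, ¬ ∀ i, rk i (mn i) < rk i y := fun y hy => by
    obtain ⟨i, hi⟩ := hB y
    exact absurd (hi _ (hmnB i)) (not_le.2 (hy i))
  have hself : ∀ j, rk j (mx j) ≤ rk j (mn j) := fun j => by
    by_contra! h
    refine hnot (mx j) fun i => ?_
    by_cases hij : i = j
    · exact hij ▸ h
    · exact hmx j i hij
  have hnotin : ∀ j, (j = i₀ ∨ j = i₁) → mx j ∉ B := by
    intro j hj hjB
    obtain ⟨i, hi'⟩ := hB (mx j)
    have h := hsurj _ hjB i hi'
    by_cases hij : i = j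
    · subst hij
      rcases hj with rfl | rfl
      · have := hmx i i₁ hi.symm
        rw [← he, h] at this
        exact lt_irrefl _ this
      · have := hmx i i₀ hi
        rw [he, h] at this
        exact lt_irrefl _ this
    · have := hmx j i hij
      rw [h] at this
      exact lt_irrefl _ this
  refine ⟨mx i₀, mx i₁, ?_, hnotin _ (Or.inl rfl), hnotin _ (Or.inr rfl), fun a ha => ⟨?_, ?_⟩⟩
  · intro h
    have h1 := hmx i₀ i₁ hi.symm
    rw [h] at h1
    exact absurd (hself i₁) (not_le.2 h1)
  · intro hd
    obtain ⟨j, hj⟩ := hd a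
    have haj : ∀ b ∈ B, rk j a < rk j b := fun b hb =>
      lt_of_le_of_ne (hj b (mem_insert_of_mem hb)) fun h => ha (hrk j h ▸ hb)
    have habove : ∀ i, i ≠ j → rk i (mn i) < rk i a := by
      intro i hij
      by_contra! hle
      have hai : rk i a < rk i (mn i) :=
        lt_of_le_of_ne hle fun h => ha (hrk i h ▸ hmnB i)
      -- Were `a` the minimum for `i` as well as `j`, only `card I - 2` rankings would be left to
      -- have their minima at the `card I - 1` points of `B`.
      have hsub : B ⊆ image mn ((univ.erase i).erase j) := by
        intro b hb
        obtain ⟨k, hk⟩ := hd b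
        have hk' := hsurj b hb k fun a ha => hk a (mem_insert_of_mem ha)
        have hka := hk a (mem_insert_self _ _)
        refine mem_image.2 ⟨k, ?_, hk'⟩
        simp only [mem_erase, mem_univ, and_true]
        refine ⟨?_, ?_⟩
        · rintro rfl
          exact absurd hka (not_le.2 (haj b hb))
        · rintro rfl
          rw [← hk'] at hka
          exact absurd hka (not_le.2 hai)
      have h1 := (card_le_card hsub).trans card_image_le
      rw [card_erase_of_mem (by simp [hij.symm]), card_erase_of_mem (mem_univ _), card_univ] at h1
      have := hne.card_pos
      omega
    -- As `a` lies below `mn j` for `j`, dominance at `mn j` comes from another ranking, which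
    -- therefore collides with `j`.
    have hj01 : j = i₀ ∨ j = i₁ := by
      obtain ⟨k, hk⟩ := hd (mn j)
      have hk' := hsurj _ (hmnB j) k fun a ha => hk a (mem_insert_of_mem ha)
      refine hpair k j ?_ hk'
      rintro rfl
      exact absurd (hk a (mem_insert_self _ _)) (not_le.2 (haj _ (hmnB k)))
    have haeq : a = mx j := by
      refine hrk j (le_antisymm (hmx' j a habove) ?_)
      obtain ⟨k, hk⟩ := hd (mx j)
      by_cases hkj : k = j
      · exact hkj ▸ hk a (mem_insert_self _ _)
      · exact absurd (hk _ (mem_insert_of_mem (hmnB k))) (not_le.2 (hmx j k hkj))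
    rcases hj01 with rfl | rfl
    · exact Or.inl haeq
    · exact Or.inr haeq
  · intro h
    obtain ⟨j, rfl⟩ : ∃ j, a = mx j := by
      rcases h with rfl | rfl
      exacts [⟨_, rfl⟩, ⟨_, rfl⟩]
    intro y
    by_cases hy : ∀ i, i ≠ j → rk i (mn i) < rk i y
    · refine ⟨j, fun a ha => ?_⟩
      have h1 := hmx' j y hy
      rcases mem_insert.1 ha with rfl | ha
      · exact h1
      · exact h1.trans ((hself j).trans (hmn j a ha))
    · push Not at hy
      obtain ⟨i, hij, hle⟩ := hy
      refine ⟨i, fun a ha => ?_⟩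
      rcases mem_insert.1 ha with rfl | ha
      · exact hle.trans (hmx j i hij).le
      · exact hle.trans (hmn i a ha)

/-- In a set that is not fully coloured, the subsets obtained by deleting one point and missing
exactly the colour `k` come in pairs. -/
theorem even_card_doors {c : T → I} {k : I} {A : Finset T} (hA : #A = Fintype.card I)
    (hc : image c A ≠ univ) :
    Even #((univ : Finset (Finset T)).filter fun B =>
      B ⊆ A ∧ #B + 1 = Fintype.card I ∧ image c B = univ.erase k) := by
  classical
  set S := (univ : Finset (Finset T)).filter fun B =>
      B ⊆ A ∧ #B + 1 = Fintype.card I ∧ image c B = univ.erase k with hS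
  rcases S.eq_empty_or_nonempty with h | ⟨B, hB⟩
  · simp [h]
  simp only [hS, mem_filter, mem_univ, true_and] at hB
  obtain ⟨hBA, hBc, hBi⟩ := hB
  obtain ⟨a, ha, rfl⟩ : ∃ a, a ∉ B ∧ insert a B = A := by
    have : #(A \ B) = 1 := by rw [card_sdiff_of_subset hBA]; omega
    obtain ⟨a, h⟩ := card_eq_one.1 this
    refine ⟨a, ?_, ?_⟩
    · have : a ∈ A \ B := by rw [h]; simp
      exact (mem_sdiff.1 this).2
    · rw [insert_eq, ← h, sdiff_union_of_subset hBA]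
  have hinj : Set.InjOn c B := by
    apply injOn_of_card_image_eq
    rw [hBi, card_erase_of_mem (mem_univ _), card_univ]; omega
  have hak : c a ≠ k := by
    intro h
    apply hc
    rw [image_insert, hBi, h, insert_erase (mem_univ _)]
  -- `B` carries each colour but `k` once, so `a` repeats the colour of a single `b`; only `a` or
  -- `b` can be deleted.
  obtain ⟨b, hb, hbc⟩ : ∃ b ∈ B, c b = c a := by
    have : c a ∈ image c B := by rw [hBi]; simp [hak]
    simpa using this
  have hab : a ≠ b := fun h => ha (h ▸ hb)
  have hpair : S = {B, (insert a B).erase b} := by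
    ext B'
    simp only [hS, mem_filter, mem_univ, true_and, mem_insert, mem_singleton]
    constructor
    · rintro ⟨hs, hcd, him⟩
      have : #(insert a B \ B') = 1 := by rw [card_sdiff_of_subset hs]; omega
      obtain ⟨x, hx⟩ := card_eq_one.1 this
      have hB' : B' = (insert a B).erase x := by
        rw [← sdiff_singleton_eq_erase, ← hx, Finset.sdiff_sdiff_eq_self hs]
      have hxA : x ∈ insert a B := by
        have : x ∈ insert a B \ B' := by rw [hx]; simp
        exact (mem_sdiff.1 this).1
      by_cases hxa : x = a
      · left; rw [hB', hxa, erase_insert ha]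
      by_cases hxb : x = b
      · right; rw [hB', hxb]
      exfalso
      have hxB : x ∈ B := (mem_insert.1 hxA).resolve_left hxa
      have hcx : c x ∈ image c B' := by
        rw [him, ← hBi]; exact mem_image_of_mem c hxB
      obtain ⟨y, hy, hyx⟩ := mem_image.1 hcx
      rw [hB', mem_erase, mem_insert] at hy
      rcases hy with ⟨hne, rfl | hy⟩
      · exact hxb (hinj hxB hb (by rw [← hyx, hbc]))
      · exact hne (hinj hy hxB hyx)
    · rintro (rfl | rfl)
      · exact ⟨hBA, hBc, hBi⟩
      · refine ⟨erase_subset _ _, ?_, ?_⟩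
        · rw [card_erase_of_mem (mem_insert_of_mem hb), hA]; omega
        · rw [← hBi]
          ext i
          simp only [mem_image, mem_erase, mem_insert]
          constructor
          · rintro ⟨x, ⟨hxb, rfl | hx⟩, rfl⟩
            · exact ⟨b, hb, hbc⟩
            · exact ⟨x, hx, rfl⟩
          · rintro ⟨x, hx, rfl⟩
            by_cases hxb : x = b
            · exact ⟨a, ⟨hab, Or.inl rfl⟩, by rw [hxb, hbc]⟩
            · exact ⟨x, ⟨hxb, Or.inr hx⟩, rfl⟩
  rw [hpair, card_pair]
  · exact even_two
  · intro h
    apply ha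
    rw [h]
    simp [hab]

/-- The supersets of `B` with one more element correspond to the points outside `B`. -/
theorem card_extensions {p : Finset T → Prop} [DecidablePred p] {B : Finset T} {n : ℕ}
    (hB : #B + 1 = n) :
    #((univ : Finset (Finset T)).filter fun A => (#A = n ∧ p A) ∧ B ⊆ A) =
      #((univ : Finset T).filter fun a => a ∉ B ∧ p (insert a B)) := by
  symm
  apply card_bij (fun a _ => insert a B)
  · intro a ha
    simp only [mem_filter, mem_univ, true_and] at ha ⊢
    exact ⟨⟨by rw [card_insert_of_notMem ha.1, hB], ha.2⟩, subset_insert _ _⟩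
  · intro a ha a' ha' h
    simp only [mem_filter, mem_univ, true_and] at ha ha'
    have : a ∈ insert a' B := h ▸ mem_insert_self a B
    exact (mem_insert.1 this).resolve_right ha.1
  · intro A hA
    simp only [mem_filter, mem_univ, true_and] at hA
    have : #(A \ B) = 1 := by rw [card_sdiff_of_subset hA.2]; omega
    obtain ⟨a, h⟩ := card_eq_one.1 this
    have haA : insert a B = A := by rw [insert_eq, ← h, sdiff_union_of_subset hA.2]
    refine ⟨a, ?_, haA⟩
    simp only [mem_filter, mem_univ, true_and, haA]
    refine ⟨?_, hA.1.2⟩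
    have : a ∈ A \ B := by rw [h]; simp
    exact (mem_sdiff.1 this).2

/-- **Scarf's lemma**, in its form for rankings with slack points `d i`: for every colouring that
gives each slack point its own colour, some dominant set carries every colour exactly once. -/
theorem exists_dominant_image_eq_univ [Nonempty I] {rk : I → T → ℕ}
    (hrk : ∀ i, Function.Injective (rk i)) {d : I → T}
    (hbot : ∀ i y, rk i (d i) ≤ rk i y)
    (htop : ∀ i j, i ≠ j → ∀ y, y ∉ Set.range d → rk i y < rk i (d j))
    (hinner : ∃ y, y ∉ Set.range d) {c : T → I} (hc : ∀ i, c (d i) = i) :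
    ∃ A, #A = Fintype.card I ∧ Dominant rk A ∧ image c A = univ := by
  classical
  by_contra! hno
  obtain ⟨k⟩ := ‹Nonempty I›
  have hd : Function.Injective d := fun i j h => by rw [← hc i, h, hc]
  set B₀ := (univ.erase k).image d with hB₀
  have hB₀mem : ∀ y, y ∈ B₀ ↔ ∃ i, i ≠ k ∧ d i = y := by simp [hB₀]
  have hbotlt : ∀ i y, y ∉ Set.range d → rk i (d i) < rk i y := fun i y hy =>
    lt_of_le_of_ne (hbot i y) fun h => hy ⟨i, hrk i h⟩
  set Rooms := (univ : Finset (Finset T)).filter fun A => #A = Fintype.card I ∧ Dominant rk A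
    with hRooms
  set Doors := (univ : Finset (Finset T)).filter fun B =>
    #B + 1 = Fintype.card I ∧ Dominant rk B ∧ image c B = univ.erase k with hDoors
  -- the outer door leads to exactly one room
  obtain ⟨a₀, ha₀, hmax⟩ := exists_max_image (univ.filter fun y => y ∉ Set.range d) (rk k)
    (by obtain ⟨y, hy⟩ := hinner; exact ⟨y, by simpa using hy⟩)
  replace ha₀ : a₀ ∉ Set.range d := (mem_filter.1 ha₀).2
  replace hmax : ∀ y, y ∉ Set.range d → rk k y ≤ rk k a₀ := fun y hy =>
    hmax y (mem_filter.2 ⟨mem_univ _, hy⟩)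
  have hdom₀ : Dominant rk (insert a₀ B₀) := by
    intro y
    by_cases hy : y ∈ Set.range d
    · obtain ⟨i, rfl⟩ := hy
      exact ⟨i, fun a _ => hbot i a⟩
    · refine ⟨k, fun a ha => ?_⟩
      rcases mem_insert.1 ha with rfl | ha
      · exact hmax y hy
      · obtain ⟨i, hik, rfl⟩ := (hB₀mem a).1 ha
        exact (htop k i hik.symm y hy).le
  have hB₀card : #B₀ + 1 = Fintype.card I := by
    rw [hB₀, card_image_of_injective _ hd, card_erase_of_mem (mem_univ _), card_univ]
    have : 0 < Fintype.card I := Fintype.card_pos_iff.2 ⟨k⟩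
    omega
  have hB₀im : image c B₀ = univ.erase k := by
    rw [hB₀, image_image]
    ext i
    simp [hc]
  have hB₀door : B₀ ∈ Doors := mem_filter.2
    ⟨mem_univ _, hB₀card, hdom₀.mono (subset_insert _ _), hB₀im⟩
  have hone : #(Rooms.filter fun A => B₀ ⊆ A) = 1 := by
    rw [hRooms, filter_filter, card_extensions hB₀card, card_eq_one]
    refine ⟨a₀, ?_⟩
    ext a
    simp only [mem_filter, mem_univ, true_and, mem_singleton]
    constructor
    · rintro ⟨haB, had⟩
      have hkey : ∀ y, y ∉ Set.range d → rk k y ≤ rk k a := by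
        intro y hy
        obtain ⟨i, hi⟩ := had y
        by_cases hik : i = k
        · exact hik ▸ hi a (mem_insert_self _ _)
        · exact absurd (hi (d i) (mem_insert_of_mem ((hB₀mem _).2 ⟨i, hik, rfl⟩)))
            (not_le.2 (hbotlt i y hy))
      have har : a ∉ Set.range d := by
        rintro ⟨i, rfl⟩
        have : i = k := by
          by_contra h
          exact haB ((hB₀mem _).2 ⟨i, h, rfl⟩)
        subst this
        exact absurd (hkey a₀ ha₀) (not_le.2 (hbotlt i a₀ ha₀))
      exact hrk k (le_antisymm (hmax a har) (hkey a₀ ha₀))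
    · rintro rfl
      refine ⟨fun h => ?_, hdom₀⟩
      obtain ⟨i, -, hi⟩ := (hB₀mem _).1 h
      exact ha₀ ⟨i, hi⟩
  have htwo : ∀ B ∈ Doors.erase B₀, Even #(Rooms.filter fun A => B ⊆ A) := by
    intro B hB
    rw [mem_erase, hDoors, mem_filter] at hB
    obtain ⟨hBne, -, hBc, hBd, hBi⟩ := hB
    have hinn : ∃ b ∈ B, b ∉ Set.range d := by
      by_contra! h
      refine hBne (eq_of_subset_of_card_le (fun b hb => ?_) (by omega))
      obtain ⟨i, rfl⟩ := h b hb
      refine (hB₀mem _).2 ⟨i, ?_, rfl⟩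
      have : c (d i) ∈ image c B := mem_image_of_mem c hb
      rw [hBi, hc] at this
      exact (mem_erase.1 this).1
    obtain ⟨b, hb, hbr⟩ := hinn
    -- The slack point `d j` is above the inner point `b` for every ranking but `j`, which supplies
    -- the required upper points.
    obtain ⟨a, a', hne, ha, ha', hiff⟩ := exists_pair_extensions hrk hBd hBc ⟨b, hb⟩
      fun j => ⟨d j, fun i hij => ⟨b, hb, htop i j hij b hbr⟩⟩
    rw [hRooms, filter_filter, card_extensions hBc]
    have : (univ.filter fun x => x ∉ B ∧ Dominant rk (insert x B)) = {a, a'} := by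
      ext x
      simp only [mem_filter, mem_univ, true_and, mem_insert, mem_singleton]
      constructor
      · rintro ⟨hx, hxd⟩
        exact (hiff x hx).1 hxd
      · rintro (rfl | rfl)
        · exact ⟨ha, (hiff _ ha).2 (Or.inl rfl)⟩
        · exact ⟨ha', (hiff _ ha').2 (Or.inr rfl)⟩
    rw [this, card_pair hne]
    exact even_two
  have hrooms : ∀ A ∈ Rooms, Even #(Doors.filter fun B => B ⊆ A) := by
    intro A hA
    rw [hRooms, mem_filter] at hA
    have h := even_card_doors (k := k) hA.2.1 (hno A hA.2.1 hA.2.2)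
    convert h using 2
    ext B
    simp only [hDoors, mem_filter, mem_univ, true_and]
    constructor
    · rintro ⟨⟨h1, -, h2⟩, h3⟩
      exact ⟨h3, h1, h2⟩
    · rintro ⟨h3, h1, h2⟩
      exact ⟨⟨h1, hA.2.2.mono h3, h2⟩, h3⟩
  -- The number of incident pairs is odd when counted by doors, owing to the outer door alone, and
  -- even when counted by rooms.
  have hcount := sum_card_bipartiteAbove_eq_sum_card_bipartiteBelow (s := Doors) (t := Rooms)
    (fun B A => B ⊆ A)
  simp only [bipartiteAbove, bipartiteBelow] at hcount
  rw [← add_sum_erase _ _ hB₀door, hone] at hcount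
  have h1 := Finset.even_sum _ htwo
  have h2 := Finset.even_sum _ hrooms
  rw [← hcount] at h2
  exact absurd h1 (by rw [add_comm, Nat.even_add_one] at h2; exact h2)

end Scarf

/-! ### Coloured grids and closed covers of the simplex. -/

namespace Scarf

open Finset

variable {I : Type*} [Fintype I] [DecidableEq I]

/-- For a colouring of the grid points of the simplex of size `N`, there are a set `C` of colours
and nearby points `p i`, `i ∈ C`, of colour `i` whose coordinates outside `C` are small. -/
theorem exists_colored_grid_points [Nonempty I] (N : ℕ) (col : (I → ℕ) → I) :
    ∃ C : Finset I, C.Nonempty ∧ ∃ (p : I → I → ℕ) (q : I → ℕ),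
      (∀ i ∈ C, ∑ k, p i k = N ∧ col (p i) = i) ∧ (∀ k, k ∉ C → q k = 0) ∧
      ∀ i ∈ C, ∀ k, q k ≤ p i k ∧ p i k ≤ q k + Fintype.card I := by
  classical
  let T := (piAntidiag (univ : Finset I) N : Finset (I → ℕ)) ⊕ I
  -- Grid values lie in `1, …, N + 1`: in coordinate `i`, the slack point of `i` is below all of
  -- them and the other slack points above. In `rk` the enumeration `e` breaks ties.
  let val : T → I → ℕ := fun t i =>
    Sum.elim (fun a => a.1 i + 1) (fun j => if i = j then 0 else N + 2) t
  let e := Fintype.equivFin T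
  let rk : I → T → ℕ := fun i t => e t + Fintype.card T * val t i
  have hmod : ∀ i t, rk i t % Fintype.card T = e t := fun i t => by
    simp only [rk, Nat.add_mul_mod_self_left]
    exact Nat.mod_eq_of_lt (e t).2
  have hdiv : ∀ i t, rk i t / Fintype.card T = val t i := fun i t => by
    have hlt : (e t : ℕ) < Fintype.card T := (e t).2
    simp only [rk]
    rw [Nat.add_mul_div_left _ _ (by omega), Nat.div_eq_of_lt hlt, zero_add]
  have hrk : ∀ i, Function.Injective (rk i) := fun i s t h => by
    apply e.injective
    apply Fin.ext
    rw [← hmod i s, h, hmod]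
  have hval : ∀ i s t, rk i s ≤ rk i t → val s i ≤ val t i := fun i s t h => by
    rw [← hdiv, ← hdiv]
    exact Nat.div_le_div_right h
  have hlt : ∀ i s t, val s i < val t i → rk i s < rk i t := fun i s t h => by
    by_contra! hle
    exact absurd (hval i t s hle) (not_le.2 h)
  have hgrid : ∀ a : (piAntidiag (univ : Finset I) N : Finset (I → ℕ)), ∑ k, a.1 k = N :=
    fun a => (mem_piAntidiag.1 a.2).1
  have hgle : ∀ (a : (piAntidiag (univ : Finset I) N : Finset (I → ℕ))) k, a.1 k ≤ N :=
    fun a k => (single_le_sum (f := a.1) (fun _ _ => Nat.zero_le _) (mem_univ k)).trans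
      (hgrid a).le
  have hmk : ∀ a : I → ℕ, ∑ k, a k = N → a ∈ piAntidiag (univ : Finset I) N := fun a ha =>
    mem_piAntidiag.2 ⟨ha, fun _ _ => mem_univ _⟩
  have hinl : ∀ a, (Sum.inl a : T) ∉ Set.range (Sum.inr : I → T) := by rintro a ⟨i, hi⟩; cases hi
  obtain ⟨k₀⟩ := id ‹Nonempty I›
  let g₀ : (piAntidiag (univ : Finset I) N : Finset (I → ℕ)) :=
    ⟨Pi.single k₀ N, hmk _ (by simp)⟩
  obtain ⟨A, -, hdom, him⟩ := exists_dominant_image_eq_univ (rk := rk) hrk (d := Sum.inr)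
    (c := Sum.elim (fun a => col a.1) id)
    (by
      intro i y
      rcases y with a | j
      · exact (hlt i _ _ (by simp [val])).le
      · by_cases h : i = j
        · rw [h]
        · exact (hlt i _ _ (by simp [val, h])).le)
    (by
      intro i j hij y hy
      rcases y with a | k
      · refine hlt i _ _ ?_
        have := hgle a i
        simp only [val, Sum.elim_inl, Sum.elim_inr, hij, if_false]
        omega
      · exact absurd ⟨k, rfl⟩ hy)
    ⟨Sum.inl g₀, hinl _⟩ (fun i => rfl)
  -- If the slack point of a colour is not in `A`, the colour must be carried by a grid point of
  -- `A`.
  let C : Finset I := univ.filter fun i => (Sum.inr i : T) ∉ A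
  have hCmem : ∀ i, i ∈ C ↔ (Sum.inr i : T) ∉ A := fun i => by simp [C]
  have hex : ∀ i, ∃ a : (piAntidiag (univ : Finset I) N : Finset (I → ℕ)),
      i ∈ C → (Sum.inl a : T) ∈ A ∧ col a.1 = i := by
    intro i
    by_cases hi : i ∈ C
    · have : i ∈ image (Sum.elim (fun a => col a.1) id : T → I) A := by
        rw [him]; exact mem_univ i
      obtain ⟨t, ht, hti⟩ := mem_image.1 this
      rcases t with a | j
      · exact ⟨a, fun _ => ⟨ht, hti⟩⟩
      · have : j = i := hti
        exact absurd (this ▸ ht) ((hCmem i).1 hi)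
    · exact ⟨g₀, fun h => absurd h hi⟩
  choose p hp using hex
  -- domination at grid points takes place in the coordinates from `C`
  have hdomC : ∀ a : (piAntidiag (univ : Finset I) N : Finset (I → ℕ)),
      ∃ i ∈ C, ∀ b, (Sum.inl b : T) ∈ A → a.1 i ≤ b.1 i := by
    intro a
    obtain ⟨i, hi⟩ := hdom (Sum.inl a)
    refine ⟨i, (hCmem i).2 fun h => ?_, fun b hb => ?_⟩
    · have := hval _ _ _ (hi _ h)
      simp [val] at this
    · have := hval _ _ _ (hi _ hb)
      simpa [val] using this
  have hC : C.Nonempty := by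
    obtain ⟨i, hi, -⟩ := hdomC g₀
    exact ⟨i, hi⟩
  obtain ⟨k₁, hk₁⟩ := hC
  have hmin : ∀ k, ∃ b, (Sum.inl b : T) ∈ A ∧ ∀ b', (Sum.inl b' : T) ∈ A → b.1 k ≤ b'.1 k := by
    intro k
    obtain ⟨b, hb, hb'⟩ := exists_min_image (univ.filter fun b => (Sum.inl b : T) ∈ A)
      (fun b => b.1 k) ⟨p k₁, by simpa using (hp k₁ hk₁).1⟩
    simp only [mem_filter, mem_univ, true_and] at hb hb'
    exact ⟨b, hb, hb'⟩
  choose b hbA hb using hmin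
  let q : I → ℕ := fun k => if k ∈ C then (b k).1 k else 0
  have hqle : ∀ a, (Sum.inl a : T) ∈ A → ∀ k, q k ≤ a.1 k := by
    intro a ha k
    by_cases hk : k ∈ C
    · simpa [q, hk] using hb k a ha
    · simp [q, hk]
  -- Otherwise some grid point exceeds the minima `q` in every coordinate of `C`, the surplus being
  -- put at `k₁`, against dominance.
  have hsum : N < ∑ k, q k + #C := by
    by_contra! hle
    let y : I → ℕ := fun k => q k + (if k ∈ C then 1 else 0) +
      (if k = k₁ then N - (∑ k, q k + #C) else 0)
    have hy : ∑ k, y k = N := by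
      simp only [y, sum_add_distrib, sum_ite_eq', mem_univ, if_true, sum_boole, Nat.cast_id]
      have : univ.filter (fun k => k ∈ C) = C := by ext; simp
      rw [this]
      omega
    obtain ⟨i, hiC, hi⟩ := hdomC ⟨y, hmk y hy⟩
    have h := hi (b i) (hbA i)
    have hqi : q i = (b i).1 i := by simp [q, hiC]
    simp only [y, hiC, if_true] at h
    omega
  refine ⟨C, ⟨k₁, hk₁⟩, fun i => (p i).1, q, fun i hi => ⟨hgrid _, (hp i hi).2⟩,
    fun k hk => by simp [q, hk], fun i hi k => ⟨hqle _ (hp i hi).1 k, ?_⟩⟩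
  have hle := hqle _ (hp i hi).1
  have h1 : ∑ k, (p i).1 k = ∑ k, q k + ∑ k, ((p i).1 k - q k) := by
    rw [← sum_add_distrib]
    exact sum_congr rfl fun k _ => by have := hle k; omega
  have h2 : (p i).1 k - q k ≤ ∑ k, ((p i).1 k - q k) :=
    single_le_sum (f := fun k => (p i).1 k - q k) (fun _ _ => Nat.zero_le _) (mem_univ k)
  have h3 : #C ≤ Fintype.card I := card_le_univ C
  have h4 := hgrid (p i)
  have h5 := hle k
  change (p i).1 k ≤ _
  omega

/-- Approximate form of the covering theorem below. -/
theorem exists_approx_mem_cover [Nonempty I] {A : I → Set (I → ℝ)}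
    (hcover : ∀ x ∈ stdSimplex ℝ I, ∃ i, x ∈ A i) {ε : ℝ} (hε : 0 < ε) :
    ∃ x ∈ stdSimplex ℝ I, ∀ i, x i ≤ ε ∨ ∃ y ∈ A i, dist x y ≤ ε := by
  classical
  obtain ⟨n, hn⟩ := exists_nat_gt (Fintype.card I / ε)
  have hcard : (0 : ℝ) < Fintype.card I := by exact_mod_cast Fintype.card_pos
  have hn0 : (0 : ℝ) < n := (by positivity : (0 : ℝ) < Fintype.card I / ε).trans hn
  have hsmall : (Fintype.card I : ℝ) / n ≤ ε := by
    rw [div_lt_iff₀ hε] at hn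
    rw [div_le_iff₀ hn0]
    linarith
  let pt : (I → ℕ) → I → ℝ := fun a k => a k / n
  have hpt : ∀ a : I → ℕ, ∑ k, a k = n → pt a ∈ stdSimplex ℝ I := by
    intro a ha
    refine ⟨fun k => by positivity, ?_⟩
    simp only [pt]
    rw [← sum_div, ← Nat.cast_sum, ha, div_self hn0.ne']
  have hcol : ∀ a : I → ℕ, ∃ i, ∑ k, a k = n → pt a ∈ A i := by
    intro a
    by_cases ha : ∑ k, a k = n
    · obtain ⟨i, hi⟩ := hcover _ (hpt a ha)
      exact ⟨i, fun _ => hi⟩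
    · exact ⟨Classical.arbitrary I, fun h => absurd h ha⟩
  choose col hcol using hcol
  obtain ⟨C, ⟨i₀, hi₀⟩, p, q, hp, hq, hpq⟩ := exists_colored_grid_points n col
  refine ⟨pt (p i₀), hpt _ (hp i₀ hi₀).1, fun i => ?_⟩
  by_cases hi : i ∈ C
  · right
    refine ⟨pt (p i), ?_, ?_⟩
    · have := hcol (p i) (hp i hi).1
      rwa [(hp i hi).2] at this
    · rw [dist_pi_le_iff hε.le]
      intro k
      refine le_trans ?_ hsmall
      have h1 := hpq i hi k
      have h2 := hpq i₀ hi₀ k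
      simp only [pt, Real.dist_eq]
      rw [← sub_div, abs_div, abs_of_pos hn0]
      gcongr
      have h3 : (p i k : ℝ) ≤ q k + Fintype.card I := by exact_mod_cast h1.2
      have h4 : (p i₀ k : ℝ) ≤ q k + Fintype.card I := by exact_mod_cast h2.2
      have h5 : (q k : ℝ) ≤ p i k := by exact_mod_cast h1.1
      have h6 : (q k : ℝ) ≤ p i₀ k := by exact_mod_cast h2.1
      rw [abs_le]
      constructor <;> linarith
  · left
    refine le_trans ?_ hsmall
    have h2 := (hpq i₀ hi₀ i).2
    rw [hq i hi, zero_add] at h2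
    simp only [pt]
    gcongr

/-- If finitely many closed sets `A i` cover the standard simplex, then some point of the simplex
lies in `A i` for each index `i` of its support. -/
theorem exists_mem_of_closed_cover [Nonempty I] {A : I → Set (I → ℝ)}
    (hA : ∀ i, IsClosed (A i)) (hcover : ∀ x ∈ stdSimplex ℝ I, ∃ i, x ∈ A i) :
    ∃ x ∈ stdSimplex ℝ I, ∀ i, x i ≠ 0 → x ∈ A i := by
  have hε : ∀ n : ℕ, (0 : ℝ) < 1 / (n + 1) := fun n => by positivity
  choose x hx hxA using fun n : ℕ => exists_approx_mem_cover hcover (hε n)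
  obtain ⟨a, ha, θ, hθ, hlim⟩ := (isCompact_stdSimplex ℝ I).tendsto_subseq hx
  have hε0 : Filter.Tendsto (fun n => (1 : ℝ) / ((θ n : ℕ) + 1)) Filter.atTop (nhds 0) :=
    tendsto_one_div_add_atTop_nhds_zero_nat.comp hθ.tendsto_atTop
  refine ⟨a, ha, fun i hi => ?_⟩
  have hpos : 0 < a i := lt_of_le_of_ne (ha.1 i) hi.symm
  have hlimi : Filter.Tendsto (fun n => x (θ n) i) Filter.atTop (nhds (a i)) :=
    (tendsto_pi_nhds.1 hlim) i
  -- A positive coordinate eventually exceeds the error, which leaves only the alternative of being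
  -- close to `A i`.
  have hev := hε0.eventually_lt hlimi hpos
  rw [← (hA i).closure_eq, Metric.mem_closure_iff]
  intro δ hδ
  have h1 := hε0.eventually (gt_mem_nhds (half_pos hδ))
  have h2 := (Metric.tendsto_nhds.1 hlim) (δ / 2) (half_pos hδ)
  obtain ⟨n, hn, hn1, hn2⟩ := (hev.and (h1.and h2)).exists
  rcases hxA (θ n) i with h | ⟨y, hy, hxy⟩
  · exact absurd h (not_le.2 hn)
  · refine ⟨y, hy, ?_⟩
    have := dist_triangle_left a y (x (θ n))
    simp only [Function.comp] at hn2
    linarith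

end Scarf

/-! ### The Ky Fan inequality. -/

open Finset in
/-- Finite form of the Ky Fan inequality. -/
theorem exists_forall_mem_finset_nonneg {E : Type*} [NormedAddCommGroup E] [NormedSpace ℝ E]
    {K : Set E} (hconv : Convex ℝ K) (hne : K.Nonempty) {Φ : E → E → ℝ}
    (hcont : ∀ y ∈ K, ContinuousOn (fun x => Φ x y) K) (hΦ : ∀ x ∈ K, ConvexOn ℝ K (Φ x))
    (hdiag : ∀ x ∈ K, 0 ≤ Φ x x) (u : Finset E) (hu : ∀ y ∈ u, y ∈ K) :
    ∃ x ∈ K, ∀ y ∈ u, 0 ≤ Φ x y := by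
  classical
  rcases u.eq_empty_or_nonempty with rfl | ⟨y₀, hy₀⟩
  · obtain ⟨x, hx⟩ := hne
    exact ⟨x, hx, by simp⟩
  have : Nonempty u := ⟨⟨y₀, hy₀⟩⟩
  let pt : (u → ℝ) → E := fun c => ∑ j, c j • (j : E)
  have hpt : ∀ c ∈ stdSimplex ℝ u, pt c ∈ K := fun c hc =>
    hconv.sum_mem (fun i _ => hc.1 i) hc.2 fun i _ => hu i i.2
  have hptc : Continuous pt := by fun_prop
  let g : u → (u → ℝ) → ℝ := fun j c => max 0 (-Φ (pt c) j)
  have hg : ∀ j, ContinuousOn (g j) (stdSimplex ℝ u) := fun j =>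
    ContinuousOn.sup continuousOn_const (((hcont j (hu j j.2)).comp hptc.continuousOn hpt).neg)
  have hg0 : ∀ j c, 0 ≤ g j c := fun j c => le_max_left _ _
  -- `g j c` is the violation at `j`. The sets ask that it be at least the weight of `j` times the
  -- total violation; summing over all indices shows that they cannot all fail.
  obtain ⟨c, hc, hcA⟩ := Scarf.exists_mem_of_closed_cover
    (A := fun i => {c | c ∈ stdSimplex ℝ u ∧ c i * ∑ j, g j c ≤ g i c})
    (fun i => (isClosed_stdSimplex ℝ u).isClosed_le
      ((continuous_apply i).continuousOn.mul (continuousOn_finsetSum _ fun j _ => hg j)) (hg i))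
    (by
      intro c hc
      by_contra! h
      have h' : ∀ i, g i c < c i * ∑ j, g j c := fun i => by
        by_contra! hle
        exact h i ⟨hc, hle⟩
      have hlt := sum_lt_sum_of_nonempty (s := univ) univ_nonempty fun i _ => h' i
      rw [← sum_mul, hc.2, one_mul] at hlt
      exact lt_irrefl _ hlt)
  refine ⟨pt c, hpt c hc, fun y hy => ?_⟩
  by_contra! hneg
  have hG : 0 < ∑ j, g j c := sum_pos' (fun j _ => hg0 j c)
    ⟨⟨y, hy⟩, mem_univ _, lt_max_of_lt_right (by simpa using hneg)⟩
  -- A positive total violation makes Φ negative at every index of positive weight; Jensen's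
  -- inequality then contradicts the sign on the diagonal.
  have hsupp : ∀ j, c j ≠ 0 → Φ (pt c) j < 0 := by
    intro j hj
    have h1 := (hcA j hj).2
    have h2 : 0 < g j c := (mul_pos (lt_of_le_of_ne (hc.1 j) hj.symm) hG).trans_le h1
    rcases lt_max_iff.1 h2 with h | h
    · exact absurd h (lt_irrefl _)
    · linarith
  have hjensen : Φ (pt c) (pt c) ≤ ∑ j, c j • Φ (pt c) j :=
    (hΦ _ (hpt c hc)).map_sum_le (fun i _ => hc.1 i) hc.2 fun i _ => hu i i.2
  have hex : ∃ j, c j ≠ 0 := by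
    by_contra! h
    have := hc.2
    simp [h] at this
  obtain ⟨j₀, hj₀⟩ := hex
  have hlt : ∑ j, c j • Φ (pt c) j < 0 := by
    refine sum_neg' (fun j _ => ?_) ⟨j₀, mem_univ _, ?_⟩
    · by_cases hj : c j = 0
      · simp [hj]
      · exact mul_nonpos_of_nonneg_of_nonpos (hc.1 j) (hsupp j hj).le
    · exact mul_neg_of_pos_of_neg (lt_of_le_of_ne (hc.1 j₀) hj₀.symm) (hsupp j₀ hj₀)
  exact absurd (hdiag _ (hpt c hc)) (by linarith)

/-- **Ky Fan inequality** on a compact convex set. -/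
theorem IsCompact.exists_forall_nonneg_of_convex {E : Type*} [NormedAddCommGroup E]
    [NormedSpace ℝ E] {K : Set E} (hK : IsCompact K) (hconv : Convex ℝ K) (hne : K.Nonempty)
    {Φ : E → E → ℝ} (hcont : ∀ y ∈ K, ContinuousOn (fun x => Φ x y) K)
    (hΦ : ∀ x ∈ K, ConvexOn ℝ K (Φ x)) (hdiag : ∀ x ∈ K, 0 ≤ Φ x x) :
    ∃ x ∈ K, ∀ y ∈ K, 0 ≤ Φ x y := by
  classical
  obtain ⟨x, hx, hxy⟩ := hK.inter_iInter_nonempty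
    (fun y : K => {x | x ∈ K ∧ 0 ≤ Φ x y})
    (fun y => hK.isClosed.isClosed_le continuousOn_const (hcont y y.2))
    (by
      intro u
      obtain ⟨x, hx, hxu⟩ := exists_forall_mem_finset_nonneg hconv hne hcont hΦ hdiag
        (u.image Subtype.val) (by
          intro y hy
          obtain ⟨z, -, rfl⟩ := Finset.mem_image.1 hy
          exact z.2)
      refine ⟨x, hx, Set.mem_iInter₂.2 fun y hy => ⟨hx, hxu y (Finset.mem_image_of_mem _ hy)⟩⟩)
  exact ⟨x, hx, fun y hy => (Set.mem_iInter.1 hxy ⟨y, hy⟩).2⟩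

/-! ### Level sets of convex functions. -/

section LevelSets

variable {E : Type*} [NormedAddCommGroup E] [NormedSpace ℝ E]

theorem LowerSemicontinuousOn.isClosed_levelSet {α : Type*} [TopologicalSpace α] {C : Set α}
    {F : α → ℝ} (hF : LowerSemicontinuousOn F C) (hC : IsClosed C) (R : ℝ) :
    IsClosed (levelSet C F R) := by
  obtain ⟨v, hv, hv'⟩ := (lowerSemicontinuousOn_iff_preimage_Iic.1 hF) R
  have : levelSet C F R = C ∩ v := hv' ▸ rfl
  exact this ▸ hC.inter hv

/-- If one level set of a lower semicontinuous convex function is nonempty and bounded, then all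
level sets are bounded. -/
theorem ConvexOn.isBounded_levelSet [FiniteDimensional ℝ E] {C : Set E} {F : E → ℝ}
    (hF : ConvexOn ℝ C F) (hC : IsClosed C) (hlsc : LowerSemicontinuousOn F C)
    (hw : WeaklyCoerciveOn C F) (R : ℝ) : Bornology.IsBounded (levelSet C F R) := by
  have : ProperSpace E := FiniteDimensional.proper ℝ E
  obtain ⟨r, ⟨x₀, hx₀, hFx₀⟩, hb⟩ := hw
  obtain ⟨M, hM0, hM⟩ := hb.subset_closedBall_lt 0 x₀
  let S := C ∩ Metric.sphere x₀ (M + 1)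
  have hScomp : IsCompact S := (isCompact_sphere x₀ (M + 1)).inter_left hC
  -- The sphere lies outside the bounded level set, so `F` exceeds `r` by a uniform `δ` on it.
  -- Convexity along rays from `x₀` then forces growth at rate `δ / (M + 1)` beyond it.
  have hδ : ∃ δ > 0, ∀ x ∈ S, r + δ ≤ F x := by
    rcases S.eq_empty_or_nonempty with h | h
    · exact ⟨1, one_pos, by simp [h]⟩
    · obtain ⟨y, hy, hmin⟩ := LowerSemicontinuousOn.exists_isMinOn h hScomp
        (hlsc.mono Set.inter_subset_left)
      have hlt : r < F y := by
        by_contra! hle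
        have h1 := hM ⟨hy.1, hle⟩
        have h2 := hy.2
        rw [Metric.mem_closedBall] at h1
        rw [Metric.mem_sphere] at h2
        linarith
      refine ⟨F y - r, sub_pos.2 hlt, fun x hx => ?_⟩
      have := hmin hx
      simp only [Set.mem_ofPred_eq] at this
      linarith
  obtain ⟨δ, hδ0, hδ⟩ := hδ
  refine (Metric.isBounded_closedBall (x := x₀)
    (r := max (M + 1) ((M + 1) * ((R - r) / δ)))).subset fun x hx => ?_
  obtain ⟨hxC, hxR⟩ := hx
  rw [Metric.mem_closedBall]
  rcases le_total (dist x x₀) (M + 1) with h | h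
  · exact h.trans (le_max_left _ _)
  · refine le_trans ?_ (le_max_right _ _)
    have hd : 0 < dist x x₀ := by linarith
    set t := (M + 1) / dist x x₀ with ht
    have ht0 : 0 < t := by positivity
    have ht1 : t ≤ 1 := (div_le_one hd).2 h
    have hmem : (1 - t) • x₀ + t • x ∈ S := by
      refine ⟨hF.1 hx₀ hxC (by linarith) ht0.le (by ring), ?_⟩
      rw [Metric.mem_sphere, dist_eq_norm]
      have : (1 - t) • x₀ + t • x - x₀ = t • (x - x₀) := by module
      rw [this, norm_smul, Real.norm_of_nonneg ht0.le, ← dist_eq_norm, ht]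
      field_simp
    have h1 := hδ _ hmem
    have h2 := hF.2 hx₀ hxC (by linarith : 0 ≤ 1 - t) ht0.le (by ring)
    simp only [smul_eq_mul] at h2
    have h3 : (1 - t) * F x₀ ≤ (1 - t) * r := by gcongr
    have h4 : t * F x ≤ t * R := by gcongr
    have h5 : δ ≤ t * (R - r) := by linarith
    have h6 : t * dist x x₀ = M + 1 := by rw [ht]; field_simp
    have h7 : dist x x₀ * δ ≤ (M + 1) * (R - r) := by
      calc dist x x₀ * δ ≤ dist x x₀ * (t * (R - r)) := by gcongr
        _ = t * dist x x₀ * (R - r) := by ring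
        _ = _ := by rw [h6]
    rw [← mul_div_assoc, le_div_iff₀ hδ0]
    exact h7

/-- A convex function that vanishes at a point `x` with `η x < ρ` and is nonnegative on the level
set `η ≤ ρ` is nonnegative on the whole set. -/
theorem ConvexOn.nonneg_of_nonneg_on_levelSet {S : Set E} {η F : E → ℝ} (hη : ConvexOn ℝ S η)
    (hF : ConvexOn ℝ S F) {x : E} (hx : x ∈ S) {ρ : ℝ} (hxρ : η x < ρ) (hFx : F x = 0)
    (h : ∀ y ∈ levelSet S η ρ, 0 ≤ F y) : ∀ y ∈ S, 0 ≤ F y := by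
  intro y hy
  rcases le_or_gt (η y) ρ with hle | hlt
  · exact h y ⟨hy, hle⟩
  · have hpos : 0 < η y - η x := by linarith
    -- For this `t` the convexity bound on `η` at `(1 - t) • x + t • y` is exactly `ρ`.
    set t := (ρ - η x) / (η y - η x) with ht
    have ht0 : 0 < t := div_pos (by linarith) hpos
    have ht1 : t ≤ 1 := (div_le_one hpos).2 (by linarith)
    have htm : t * (η y - η x) = ρ - η x := by rw [ht]; field_simp
    have h1 := hη.2 hx hy (by linarith : 0 ≤ 1 - t) ht0.le (by ring)
    have h2 := hF.2 hx hy (by linarith : 0 ≤ 1 - t) ht0.le (by ring)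
    simp only [smul_eq_mul] at h1 h2
    have h3 := h _ ⟨hη.1 hx hy (by linarith : 0 ≤ 1 - t) ht0.le (by ring), by linarith⟩
    rw [hFx] at h2
    have h4 : 0 ≤ t * F y := by linarith
    exact nonneg_of_mul_nonneg_right h4 ht0

end LevelSets

/-! ### Convexity and continuity of the game data and the penalty. -/

namespace JointGame

variable {l m : ℕ} {G : JointGame l m}

theorem X_eq_pi : G.X = Set.pi Set.univ G.strat := by
  ext x
  simp [X]

theorem update_mem_X {x y : G.Profile} (hx : x ∈ G.X) (i : Fin l) (hy : y i ∈ G.strat i) :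
    Function.update x i (y i) ∈ G.X := by
  intro j
  by_cases h : j = i
  · subst h; simpa using hy
  · simpa [h] using hx j

theorem Phi_self (x : G.Profile) : G.Phi x x = 0 := sub_self _

namespace BasicAssumptions

theorem isClosed_X (hA : G.BasicAssumptions) : IsClosed G.X := by
  rw [X_eq_pi]
  exact isClosed_set_pi fun i _ => hA.strat_closed i

theorem convex_X (hA : G.BasicAssumptions) : Convex ℝ G.X := by
  rw [X_eq_pi]
  exact convex_pi fun i _ => hA.strat_convex i

theorem continuous_h (hA : G.BasicAssumptions) (i : Fin l) : Continuous (G.h i) :=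
  continuous_pi fun j => (hA.constraint_convex i j).locallyLipschitz.continuous

/-- `Psi x` is a sum of functions, each concave in its own coordinate of `y`. -/
theorem convexOn_Phi (hA : G.BasicAssumptions) {x : G.Profile} (hx : x ∈ G.X) :
    ConvexOn ℝ G.X (G.Phi x) := by
  refine ⟨hA.convex_X, fun y hy z hz a b ha hb hab => ?_⟩
  have h : a * G.Psi x y + b * G.Psi x z ≤ G.Psi x (a • y + b • z) := by
    simp only [Psi, Finset.mul_sum, ← Finset.sum_add_distrib]
    exact Finset.sum_le_sum fun i _ =>
      (hA.utility_concave i x hx).2 (hy i) (hz i) ha hb hab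
  simp only [Phi, smul_eq_mul]
  have h2 : a * G.Psi x x + b * G.Psi x x = G.Psi x x := by rw [← add_mul, hab, one_mul]
  linarith

theorem continuousOn_Phi (hA : G.BasicAssumptions) {y : G.Profile} (hy : y ∈ G.X) :
    ContinuousOn (fun x => G.Phi x y) G.X := by
  unfold Phi Psi
  refine ContinuousOn.sub (continuousOn_finsetSum _ fun i _ => ?_)
    (continuousOn_finsetSum _ fun i _ => ?_)
  · simp only [Function.update_eq_self]
    exact hA.utility_continuous i
  · exact (hA.utility_continuous i).comp (continuous_id.update i continuous_const).continuousOn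
      fun x hx => update_mem_X hx i (hy i)

theorem isClosed_D (hA : G.BasicAssumptions) : IsClosed G.D :=
  hA.isClosed_X.inter <| isClosed_le
    (continuous_finsetSum _ fun i _ => (hA.continuous_h i).comp (continuous_apply i))
    continuous_const

theorem h_convex_le (hA : G.BasicAssumptions) (i : Fin l) (x y : EuclideanSpace ℝ (Fin (G.n i)))
    {a b : ℝ} (ha : 0 ≤ a) (hb : 0 ≤ b) (hab : a + b = 1) : G.h i (a • x + b • y) ≤ a • G.h i x + b • G.h i y :=
  fun j => (hA.constraint_convex i j).2 (Set.mem_univ x) (Set.mem_univ y) ha hb hab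

theorem convex_D (hA : G.BasicAssumptions) : Convex ℝ G.D := by
  refine hA.convex_X.inter fun x hx y hy a b ha hb hab => ?_
  calc ∑ i, G.h i ((a • x + b • y) i)
      ≤ ∑ i, (a • G.h i (x i) + b • G.h i (y i)) :=
        Finset.sum_le_sum fun i _ => hA.h_convex_le i _ _ ha hb hab
    _ = a • ∑ i, G.h i (x i) + b • ∑ i, G.h i (y i) := by
        rw [Finset.sum_add_distrib, Finset.smul_sum, Finset.smul_sum]
    _ ≤ a • G.b + b • G.b := add_le_add (smul_le_smul_of_nonneg_left hx ha)
        (smul_le_smul_of_nonneg_left hy hb)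
    _ = G.b := by rw [← add_smul, hab, one_smul]

end BasicAssumptions

section Penalty

variable {φ : (Fin m → ℝ) → ℝ}

theorem _root_.IsPenaltyGenerator.nonneg (hφ : IsPenaltyGenerator φ) (v : Fin m → ℝ) : 0 ≤ φ v := by
  by_cases h : v ≤ 0
  · exact (hφ.eq_zero v h).ge
  · exact (hφ.pos v h).le

theorem P_nonneg (hφ : IsPenaltyGenerator φ) (w : G.Profile × (Fin l → Fin m → ℝ)) : 0 ≤ G.P φ w :=
  Finset.sum_nonneg fun _ _ => hφ.nonneg _

theorem P_eq_zero_iff (hφ : IsPenaltyGenerator φ) (w : G.Profile × (Fin l → Fin m → ℝ)) :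
    G.P φ w = 0 ↔ ∀ i, G.h i (w.1 i) ≤ w.2 i := by
  rw [P, Finset.sum_eq_zero_iff_of_nonneg fun _ _ => hφ.nonneg _]
  refine ⟨fun h i => ?_, fun h i _ => hφ.eq_zero _ (sub_nonpos.2 (h i))⟩
  by_contra hi
  exact absurd (h i (Finset.mem_univ i)) (hφ.pos _ fun h' => hi (sub_nonpos.1 h')).ne'

theorem continuous_P (hφ : IsPenaltyGenerator φ) (hA : G.BasicAssumptions) :
    Continuous (G.P φ) := by
  refine continuous_finsetSum _ fun i _ => hφ.differentiable.continuous.comp (Continuous.sub ?_ ?_)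
  · exact (hA.continuous_h i).comp ((continuous_apply i).comp continuous_fst)
  · exact (continuous_apply i).comp continuous_snd

/-- An isotone convex function of a componentwise convex map is convex; the partition enters
linearly. -/
theorem convexOn_P (hφ : IsPenaltyGenerator φ) (hA : G.BasicAssumptions) :
    ConvexOn ℝ Set.univ (G.P φ) := by
  refine ⟨convex_univ, fun w _ w' _ a b ha hb hab => ?_⟩
  simp only [P, Finset.smul_sum, ← Finset.sum_add_distrib]
  refine Finset.sum_le_sum fun i _ => le_trans (hφ.isotone ?_)
    (hφ.convex.2 (Set.mem_univ _) (Set.mem_univ _) ha hb hab)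
  have h := hA.h_convex_le i (w.1 i) (w'.1 i) ha hb hab
  have e : a • (G.h i (w.1 i) - w.2 i) + b • (G.h i (w'.1 i) - w'.2 i) =
      (a • G.h i (w.1 i) + b • G.h i (w'.1 i)) - (a • w + b • w').2 i := by
    simp only [Prod.snd_add, Prod.smul_snd, Pi.add_apply, Pi.smul_apply]
    module
  rw [e]
  exact sub_le_sub_right h _

variable {U₀ : Set (Fin l → Fin m → ℝ)}

theorem mem_D_of_P_eq_zero (hφ : IsPenaltyGenerator φ) {w : G.Profile × (Fin l → Fin m → ℝ)}
    (hw : w ∈ G.X ×ˢ G.U U₀) (h : G.P φ w = 0) : w.1 ∈ G.D :=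
  ⟨hw.1, (Finset.sum_le_sum fun i _ => (P_eq_zero_iff hφ w).1 h i).trans hw.2.2.le⟩

/-- These penalty-free lifts of feasible strategies are the test points for the penalized problem.
-/
theorem exists_P_eq_zero (hφ : IsPenaltyGenerator φ) (hU : G.AdmissibleRestriction U₀)
    {x : G.Profile} (hx : x ∈ G.D) : ∃ u ∈ G.U U₀, G.P φ (x, u) = 0 := by
  obtain ⟨u, hu, h⟩ := hU.covers x hx
  exact ⟨u, hu, (P_eq_zero_iff hφ _).2 h⟩

end Penalty

end JointGame

/-! ### Existence for the equilibrium problem and the penalized problem. -/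

namespace JointGame

variable {l m : ℕ} {G : JointGame l m} {μ : G.Profile → ℝ} {r : ℝ}
  {U₀ : Set (Fin l → Fin m → ℝ)} {φ : (Fin m → ℝ) → ℝ}

theorem Coercivity.isCompact_levelSet (hC : G.Coercivity μ r) (hA : G.BasicAssumptions) (ρ : ℝ) :
    IsCompact (levelSet G.X μ ρ) :=
  Metric.isCompact_of_isClosed_isBounded (hC.lsc.isClosed_levelSet hA.isClosed_X ρ)
    (hC.convex.isBounded_levelSet hA.isClosed_X hC.lsc hC.weaklyCoercive ρ)

theorem Coercivity.convex_levelSet (hC : G.Coercivity μ r) (ρ : ℝ) :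
    Convex ℝ (levelSet G.X μ ρ) :=
  hC.convex.convex_le ρ

/-- The level sets of `η` are bounded. -/
theorem isBounded_levelSet_eta (hA : G.BasicAssumptions) (hU : G.AdmissibleRestriction U₀)
    (hφ : IsPenaltyGenerator φ) (hC : G.Coercivity μ r) {z : G.Profile} (hz : z ∈ G.D) {ρ : ℝ}
    (hzρ : μ z ≤ ρ) :
    Bornology.IsBounded (levelSet (G.X ×ˢ G.U U₀) (G.eta φ μ) ρ) := by
  set B := levelSet G.X μ ρ
  have hB : IsCompact B := hC.isCompact_levelSet hA ρ
  have hconv : Convex ℝ (B ×ˢ G.U U₀) := (hC.convex_levelSet ρ).prod hU.convex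
  have hP : ConvexOn ℝ (B ×ˢ G.U U₀) (G.P φ) := (convexOn_P hφ hA).subset (Set.subset_univ _) hconv
  obtain ⟨u₀, hu₀, hPu₀⟩ := exists_P_eq_zero hφ hU hz
  have hcont : Continuous fun x : G.Profile => fun i => G.h i (x i) :=
    continuous_pi fun i => (hA.continuous_h i).comp (continuous_apply i)
  obtain ⟨M, hM⟩ := hB.exists_bound_of_continuousOn hcont.continuousOn
  have hMij : ∀ x ∈ B, ∀ i j, -M ≤ G.h i (x i) j := by
    intro x hx i j
    have h1 := (norm_le_pi_norm (G.h i (x i)) j).trans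
      ((norm_le_pi_norm (fun i => G.h i (x i)) i).trans (hM x hx))
    rw [Real.norm_eq_abs] at h1
    exact (abs_le.1 h1).1
  -- Where `P` vanishes, each `u i` is bounded below by the values of `h i` on the compact `B`, and
  -- then above because the sum is `b`.
  have hw : WeaklyCoerciveOn (B ×ˢ G.U U₀) (G.P φ) := by
    refine ⟨0, ⟨(z, u₀), ⟨⟨hz.1, hzρ⟩, hu₀⟩, hPu₀.le⟩, ?_⟩
    have hIcc : Bornology.IsBounded (Set.Icc (fun _ _ => -M : Fin l → Fin m → ℝ)
        (fun _ j => G.b j + l * M)) := isCompact_Icc.isBounded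
    refine (hB.isBounded.prod hIcc).subset fun w hw => ⟨hw.1.1, ?_⟩
    have h0 := (P_eq_zero_iff hφ w).1 (le_antisymm hw.2 (P_nonneg hφ w))
    have hlow : ∀ i j, -M ≤ w.2 i j := fun i j => (hMij _ hw.1.1 i j).trans (h0 i j)
    refine ⟨hlow, fun i j => ?_⟩
    have hsum : ∑ i, w.2 i j = G.b j := by
      rw [← hw.1.2.2, Finset.sum_apply]
    have h1 := Finset.single_le_sum (f := fun i => w.2 i j + M)
      (fun i _ => by have := hlow i j; linarith) (Finset.mem_univ i)
    simp only [Finset.sum_add_distrib, hsum, Finset.sum_const, Finset.card_univ, Fintype.card_fin,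
      nsmul_eq_mul] at h1
    have hM0 : 0 ≤ M := (norm_nonneg _).trans (hM _ hw.1.1)
    change w.2 i j ≤ G.b j + l * M
    linarith
  refine (hP.isBounded_levelSet (hB.isClosed.prod hU.closed)
    (continuous_P hφ hA).continuousOn.lowerSemicontinuousOn hw ρ).subset fun w hw => ?_
  have := max_le_iff.1 hw.2
  exact ⟨⟨⟨hw.1.1, this.1⟩, hw.1.2⟩, this.2⟩

theorem isCompact_levelSet_eta (hA : G.BasicAssumptions) (hU : G.AdmissibleRestriction U₀)
    (hφ : IsPenaltyGenerator φ) (hC : G.Coercivity μ r) {z : G.Profile} (hz : z ∈ G.D) {ρ : ℝ}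
    (hzρ : μ z ≤ ρ) :
    IsCompact (levelSet (G.X ×ˢ G.U U₀) (G.eta φ μ) ρ) := by
  refine Metric.isCompact_of_isClosed_isBounded ?_ (isBounded_levelSet_eta hA hU hφ hC hz hzρ)
  have : levelSet (G.X ×ˢ G.U U₀) (G.eta φ μ) ρ =
      (levelSet G.X μ ρ ×ˢ G.U U₀) ∩ {w | G.P φ w ≤ ρ} := by
    ext w
    simp only [levelSet, eta, max_le_iff, Set.mem_inter_iff, Set.mem_prod, Set.mem_ofPred_eq]
    tauto
  rw [this]
  exact ((hC.isCompact_levelSet hA ρ).isClosed.prod hU.closed).inter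
    (isClosed_le (continuous_P hφ hA) continuous_const)

theorem convexOn_eta (hA : G.BasicAssumptions) (hU : G.AdmissibleRestriction U₀)
    (hφ : IsPenaltyGenerator φ) (hC : G.Coercivity μ r) :
    ConvexOn ℝ (G.X ×ˢ G.U U₀) (G.eta φ μ) := by
  have hconv : Convex ℝ (G.X ×ˢ G.U U₀) := hA.convex_X.prod hU.convex
  refine ConvexOn.sup ⟨hconv, fun w hw w' hw' a b ha hb hab => ?_⟩
    ((convexOn_P hφ hA).subset (Set.subset_univ _) hconv)
  exact hC.convex.2 hw.1 hw'.1 ha hb hab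

/-- Ky Fan on the part of `D` where `μ ≤ ρ`: `μ z ≤ ρ` makes it nonempty, and `r < ρ` puts the
solution, which has `μ ≤ r` by descent, strictly inside. -/
theorem exists_isNormalizedEquilibrium (hA : G.BasicAssumptions) (hC : G.Coercivity μ r) :
    ∃ x, G.IsNormalizedEquilibrium x := by
  obtain ⟨z, hz⟩ := hA.feasible_nonempty
  have hDX : G.D ⊆ G.X := Set.inter_subset_left
  set ρ := max (μ z) (r + 1)
  have hrρ : r < ρ := (lt_add_one r).trans_le (le_max_right _ _)
  have hμD : ConvexOn ℝ G.D μ := hC.convex.subset hDX hA.convex_D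
  have hK : IsCompact (levelSet G.D μ ρ) := by
    have : levelSet G.D μ ρ = levelSet G.X μ ρ ∩ G.D := by
      ext x
      exact ⟨fun h => ⟨⟨hDX h.1, h.2⟩, h.1⟩, fun h => ⟨h.2, h.1.2⟩⟩
    exact this ▸ (hC.isCompact_levelSet hA ρ).inter_right hA.isClosed_D
  have hKX : levelSet G.D μ ρ ⊆ G.X := fun x hx => hDX hx.1
  have hKc : Convex ℝ (levelSet G.D μ ρ) := hμD.convex_le ρ
  obtain ⟨x, hx, hxK⟩ := hK.exists_forall_nonneg_of_convex hKc
    ⟨z, hz, le_max_left _ _⟩ (Φ := G.Phi)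
    (fun y hy => (hA.continuousOn_Phi (hKX hy)).mono hKX)
    (fun x hx => (hA.convexOn_Phi (hKX hx)).subset hKX hKc) (fun x _ => (Phi_self x).ge)
  have hxr : μ x ≤ r := by
    by_contra hlt
    obtain ⟨y, hyD, hyx, hneg⟩ := hC.descent x ⟨hKX hx, fun h => hlt h.2⟩
    exact absurd (hxK y ⟨hyD, hyx.trans hx.2⟩) (not_le.2 hneg)
  exact ⟨x, hx.1, hμD.nonneg_of_nonneg_on_levelSet
    ((hA.convexOn_Phi (hKX hx)).subset hDX hA.convex_D) hx.1 (hxr.trans_lt hrρ) (Phi_self x) hxK⟩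

/-- Solutions of the penalized problem lie in the level set of `μ`. -/
theorem IsPenaltySolution.fst_mem_levelSet {t : ℝ} {w : G.Profile × (Fin l → Fin m → ℝ)}
    (hw : G.IsPenaltySolution U₀ φ t w) (hU : G.AdmissibleRestriction U₀)
    (hφ : IsPenaltyGenerator φ) (hC : G.Coercivity μ r) (ht : 0 < t) :
    w.1 ∈ levelSet G.X μ r := by
  by_contra hlt
  obtain ⟨y, hyD, -, hneg⟩ := hC.descent w.1 ⟨hw.1.1, hlt⟩
  obtain ⟨u, hu, hPu⟩ := exists_P_eq_zero hφ hU hyD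
  have h := hw.2 (y, u) ⟨hyD.1, hu⟩
  have h2 := mul_nonneg ht.le (P_nonneg hφ w)
  rw [hPu] at h
  simp only at h
  linarith

/-- Comparison with a penalty-free lift of `y`. For `t > 0` it both bounds the infeasibility by `Phi
/ t` and gives the sign of `Phi`. -/
theorem IsPenaltySolution.mul_P_le {t : ℝ} {w : G.Profile × (Fin l → Fin m → ℝ)}
    (hw : G.IsPenaltySolution U₀ φ t w) (hU : G.AdmissibleRestriction U₀)
    (hφ : IsPenaltyGenerator φ) {y : G.Profile} (hy : y ∈ G.D) :
    t * G.P φ w ≤ G.Phi w.1 y := by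
  obtain ⟨u, hu, hPu⟩ := exists_P_eq_zero hφ hU hy
  have h := hw.2 (y, u) ⟨hy.1, hu⟩
  rw [hPu] at h
  simp only at h
  linarith

/-- The penalized problem has a solution as soon as the penalty of the points `w` of the level set
with `t * P w ≤ Φ (w, z)` stays below `ρ`. -/
theorem exists_isPenaltySolution (hA : G.BasicAssumptions) (hU : G.AdmissibleRestriction U₀)
    (hφ : IsPenaltyGenerator φ) (hC : G.Coercivity μ r) {z : G.Profile} (hz : z ∈ G.D) {ρ t : ℝ}
    (hzρ : μ z ≤ ρ) (hρ : 0 < ρ) (hrρ : r < ρ) (ht : 0 < t)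
    (hlarge : ∀ x ∈ levelSet G.X μ r, G.Phi x z < t * ρ) :
    ∃ w, G.IsPenaltySolution U₀ φ t w := by
  set K := levelSet (G.X ×ˢ G.U U₀) (G.eta φ μ) ρ
  have hK : IsCompact K := isCompact_levelSet_eta hA hU hφ hC hz hzρ
  have hη := convexOn_eta (U₀ := U₀) hA hU hφ hC
  have hKS : K ⊆ G.X ×ˢ G.U U₀ := fun w hw => hw.1
  have hKc : Convex ℝ K := hη.convex_le ρ
  let F : G.Profile × (Fin l → Fin m → ℝ) → G.Profile × (Fin l → Fin m → ℝ) → ℝ :=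
    fun w w' => G.Phi w.1 w'.1 + t * (G.P φ w' - G.P φ w)
  have hF0 : ∀ w, F w w = 0 := fun w => by simp [F, Phi_self]
  have hFconv : ∀ w ∈ G.X ×ˢ G.U U₀, ConvexOn ℝ (G.X ×ˢ G.U U₀) (F w) := by
    intro w hw
    refine ⟨hη.1, fun v hv v' hv' a b ha hb hab => ?_⟩
    have h1 := (hA.convexOn_Phi hw.1).2 hv.1 hv'.1 ha hb hab
    have h2 := mul_le_mul_of_nonneg_left
      ((convexOn_P (G := G) hφ hA).2 (Set.mem_univ v) (Set.mem_univ v') ha hb hab) ht.le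
    have h3 : t * G.P φ w = a * (t * G.P φ w) + b * (t * G.P φ w) := by
      rw [← add_mul, hab, one_mul]
    simp only [F, smul_eq_mul, Prod.fst_add, Prod.smul_fst] at h1 h2 ⊢
    linarith
  have hFcont : ∀ w' ∈ K, ContinuousOn (fun w => F w w') K := by
    intro w' hw'
    refine ContinuousOn.add ?_ (continuousOn_const.mul
      (continuousOn_const.sub (continuous_P hφ hA).continuousOn))
    exact (hA.continuousOn_Phi hw'.1.1).comp continuous_fst.continuousOn fun w hw => hw.1.1
  have hmemK : ∀ y ∈ G.D, μ y ≤ ρ → ∃ w ∈ K, w.1 = y ∧ G.P φ w = 0 := by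
    intro y hy hyρ
    obtain ⟨u, hu, hPu⟩ := exists_P_eq_zero hφ hU hy
    exact ⟨(y, u), ⟨⟨hy.1, hu⟩, max_le hyρ (hPu.le.trans hρ.le)⟩, rfl, hPu⟩
  obtain ⟨w₀, hw₀, -⟩ := hmemK z hz hzρ
  obtain ⟨w, hw, hwK⟩ := hK.exists_forall_nonneg_of_convex hKc ⟨w₀, hw₀⟩ hFcont
    (fun w hw => (hFconv w hw.1).subset hKS hKc) (fun w _ => (hF0 w).ge)
  have hkey : ∀ y ∈ G.D, μ y ≤ ρ → t * G.P φ w ≤ G.Phi w.1 y := by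
    intro y hy hyρ
    obtain ⟨w', hw', rfl, hP'⟩ := hmemK y hy hyρ
    have h : 0 ≤ G.Phi w.1 w'.1 + t * (G.P φ w' - G.P φ w) := hwK w' hw'
    rw [hP'] at h
    linarith
  -- The descent point does not increase `μ`, so its lift is a test point inside `K`.
  have hwr : w.1 ∈ levelSet G.X μ r := by
    by_contra hlt
    obtain ⟨y, hyD, hyx, hneg⟩ := hC.descent w.1 ⟨hw.1.1, hlt⟩
    have h := hkey y hyD (hyx.trans ((le_max_left _ _).trans hw.2))
    have h2 := mul_nonneg ht.le (P_nonneg hφ w)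
    linarith
  have hPρ : G.P φ w < ρ :=
    lt_of_mul_lt_mul_left ((hkey z hz hzρ).trans_lt (hlarge _ hwr)) ht.le
  exact ⟨w, hw.1, hη.nonneg_of_nonneg_on_levelSet (hFconv w hw.1) hw.1
    (max_lt (hwr.2.trans_lt hrρ) hPρ) (hF0 w) hwK⟩

end JointGame

/-! ### The threshold for τ and the passage to the limit. -/

open JointGame in
theorem theorem4p2 {l m : ℕ} (G : JointGame l m) (hA : G.BasicAssumptions)
    (U₀ : Set (Fin l → Fin m → ℝ)) (hU : G.AdmissibleRestriction U₀)
    (φ : (Fin m → ℝ) → ℝ) (hφ : IsPenaltyGenerator φ)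
    (μ : G.Profile → ℝ) (r : ℝ) (hC : G.Coercivity μ r)
    (τ : ℕ → ℝ) (hτ_pos : ∀ k, 0 < τ k) (hτ : Filter.Tendsto τ Filter.atTop Filter.atTop) :
    (∃ x, G.IsNormalizedEquilibrium x) ∧
    WeaklyCoerciveOn (G.X ×ˢ G.U U₀) (G.eta φ μ) ∧
    (∃ τ' : ℝ, 0 < τ' ∧ ∀ t, τ' < t →
      (∃ w, G.IsPenaltySolution U₀ φ t w) ∧
      (0 < r → ∀ w, G.IsPenaltySolution U₀ φ t w →
        w ∈ levelSet (G.X ×ˢ G.U U₀) (G.eta φ μ) r)) ∧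
    (∀ w : ℕ → G.Profile × (Fin l → Fin m → ℝ),
      (∀ k, G.IsPenaltySolution U₀ φ (τ k) (w k)) →
        (∃ w', MapClusterPt w' Filter.atTop w) ∧
        ∀ w', MapClusterPt w' Filter.atTop w →
          w' ∈ (levelSet G.X μ r ∩ G.D) ×ˢ G.U U₀ ∧ G.IsNormalizedEquilibrium w'.1) := by
  obtain ⟨z, hz⟩ := hA.feasible_nonempty
  obtain ⟨ρ, hρ, hzρ, hrρ⟩ : ∃ ρ : ℝ, 0 < ρ ∧ μ z ≤ ρ ∧ r < ρ :=
    ⟨|μ z| + |r| + 1, by positivity, by linarith [le_abs_self (μ z), abs_nonneg r],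
      by linarith [le_abs_self r, abs_nonneg (μ z)]⟩
  obtain ⟨M, hM⟩ : ∃ M : ℝ, ∀ x ∈ levelSet G.X μ r, |G.Phi x z| ≤ M :=
    (hC.isCompact_levelSet hA r).exists_bound_of_continuousOn
      ((hA.continuousOn_Phi hz.1).mono fun x hx => hx.1)
  have hPbound : ∀ t ε : ℝ, 0 < t → M ≤ t * ε → ∀ w, G.IsPenaltySolution U₀ φ t w →
      G.P φ w ≤ ε := by
    intro t ε ht hMt w hw
    have h1 := hw.mul_P_le hU hφ hz
    have h2 := (le_abs_self _).trans (hM _ (hw.fst_mem_levelSet hU hφ hC ht))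
    exact le_of_mul_le_mul_left (h1.trans (h2.trans hMt)) ht
  refine ⟨exists_isNormalizedEquilibrium hA hC, ?_, ?_, ?_⟩
  · obtain ⟨u, hu, hPu⟩ := exists_P_eq_zero hφ hU hz
    exact ⟨ρ, ⟨(z, u), ⟨hz.1, hu⟩, max_le hzρ (hPu.le.trans hρ.le)⟩,
      isBounded_levelSet_eta hA hU hφ hC hz hzρ⟩
  -- The first term gives `M < t * ρ`, needed for existence; the second gives `M ≤ t * r` when `r >
  -- 0`, and `|r|` keeps it nonnegative for any `r`.
  · refine ⟨(|M| + 1) / ρ + |M| / |r|, by positivity, fun t ht => ?_⟩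
    have hq : (0 : ℝ) ≤ |M| / |r| := by positivity
    have hq' : (0 : ℝ) < (|M| + 1) / ρ := by positivity
    have ht0 : 0 < t := by linarith
    refine ⟨exists_isPenaltySolution hA hU hφ hC hz hzρ hρ hrρ ht0 fun x hx => ?_, ?_⟩
    · have h1 : (|M| + 1) / ρ < t := by linarith
      rw [div_lt_iff₀ hρ] at h1
      have h2 := (le_abs_self _).trans (hM x hx)
      have h3 := le_abs_self M
      linarith
    · intro hr w hw
      have h1 : |M| / |r| < t := by linarith
      rw [abs_of_pos hr, div_lt_iff₀ hr] at h1
      exact ⟨hw.1, max_le (hw.fst_mem_levelSet hU hφ hC ht0).2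
        (hPbound t r ht0 ((le_abs_self M).trans h1.le) w hw)⟩
  · intro w hw
    have hwr : ∀ k, (w k).1 ∈ levelSet G.X μ r := fun k =>
      (hw k).fst_mem_levelSet hU hφ hC (hτ_pos k)
    have hPsmall : ∀ ε : ℝ, 0 < ε → ∀ᶠ k in Filter.atTop, G.P φ (w k) ≤ ε := by
      intro ε hε
      filter_upwards [hτ.eventually_ge_atTop (M / ε)] with k hk
      rw [div_le_iff₀ hε] at hk
      exact hPbound _ _ (hτ_pos k) hk _ (hw k)
    constructor
    · obtain ⟨w', -, hw'⟩ := (isCompact_levelSet_eta hA hU hφ hC hz hzρ).exists_mapClusterPt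
        (f := Filter.atTop) (u := w) (by
          rw [Filter.le_principal_iff, Filter.mem_map]
          filter_upwards [hPsmall ρ hρ] with k hk
          exact ⟨(hw k).1, max_le ((hwr k).2.trans hrρ.le) hk⟩)
      exact ⟨w', hw'⟩
    · intro w' hw'
      have hmem : w' ∈ levelSet G.X μ r ×ˢ G.U U₀ :=
        ((hC.isCompact_levelSet hA r).isClosed.prod hU.closed).mem_of_mapClusterPt hw'
          (Filter.Eventually.of_forall fun k => ⟨hwr k, (hw k).1.2⟩)
      have hP0 : G.P φ w' = 0 := by
        refine le_antisymm (le_of_forall_pos_le_add fun ε hε => ?_) (P_nonneg hφ w')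
        rw [zero_add]
        exact (isClosed_le (continuous_P hφ hA) continuous_const).mem_of_mapClusterPt hw'
          (hPsmall ε hε)
      have hD : w'.1 ∈ G.D := mem_D_of_P_eq_zero hφ ⟨hmem.1.1, hmem.2⟩ hP0
      refine ⟨⟨⟨hmem.1, hD⟩, hmem.2⟩, hD, fun y hy => ?_⟩
      -- For fixed `y` in `D`, `Phi` is at least `τ k * P ≥ 0` along the sequence; closedness
      -- carries the sign to the limit point.
      have hcl : IsClosed {v : G.Profile × (Fin l → Fin m → ℝ) |
          v ∈ G.X ×ˢ G.U U₀ ∧ 0 ≤ G.Phi v.1 y} :=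
        (hA.isClosed_X.prod hU.closed).isClosed_le continuousOn_const
          ((hA.continuousOn_Phi hy.1).comp continuous_fst.continuousOn fun v hv => hv.1)
      exact (hcl.mem_of_mapClusterPt hw' (Filter.Eventually.of_forall fun k => ⟨(hw k).1,
        (mul_nonneg (hτ_pos k).le (P_nonneg hφ _)).trans ((hw k).mul_P_le hU hφ hy)⟩)).2
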